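/- Let $A\in\mathbb R^{n\times n}$, $B\in\mathbb R^{n\times m}$, $H\in\mathbb R^{p\times n}$, let $\mathscr U\subseteq\mathbb R^m$ be the input set, and let $\mathbf M$ be the linear stochastic system $$x(t+1)=Ax(t)+Bu(t)+w(t),\qquad z(t)=Hx(t),\qquad t=0,1,2,\dots,$$ where $x(0)\sim\mathcal N(\mu_0,\Sigma_0)$ and the $w(t)\sim\mathcal N(0,Q_w)$ are i.i.d. and independent of $x(0)$. Let $C\in\mathbb R^{q\times n}$ and $N\in\mathbb R^{p\times q}$ satisfy $NC=H$ and $q<n$. Suppose that $\Sigma_0\succ0$ and $C\Sigma_0C^T\succ0$, and that $X=\Sigma_0$ is a stabilizing solution of the discrete-time algebraic Riccati equation $$X=AXA^T-AXC^T(CXC^T)^{-1}CXA^T+Q_w,$$ i.e. $X$ solves this equation and all eigenvalues of $A-FC$, where $F=AXC^T(CXC^T)^{-1}$, lie in the open unit disc. Put $K=\Sigma_0C^T(C\Sigma_0C^T)^{-1}$ and $P=\Sigma_0-KC\Sigma_0$, and let $\bar{\mathbf M}$ be the time-invariant abstract model $$\bar x(t+1)=A\bar x(t)+B\bar u(t)+Kv(t+1),\qquad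 \bar z(t)=H\bar x(t),$$ where $\bar x(0)\sim\mathcal N(\mu_0,\Sigma_0-P)$ and the $v(t)\sim\mathcal N(0,C\Sigma_0C^T)$, $t\ge1$, are i.i.d. and independent of $\bar x(0)$. A controller for either model is a sequence of Borel measurable policies $\mathbf C_t:(\mathbb R^n\times\mathscr U)^t\times\mathbb R^n\to\mathscr U$, $t\ge0$, which selects the input at time $t$ from the history $x(0),u(0),\dots,x(t-1),u(t-1),x(t)$ of states and inputs of that model. The controlled system induces a probability distribution of output trajectories $\boldsymbol z=z(0)z(1)z(2)\cdots$ on $\mathcal Z=(\mathbb R^p)^{\mathbb N}$, denoted $\mathbb P_{\mathbf C\times\mathbf M}$ and $\mathbb P_{\bar{\mathbf C}\times\bar{\mathbf M}}$ respectively. Then for every controller $\bar{\mathbf C}$ of $\bar{\mathbf M}$ there exists a controller $\mathbf C$ of $\mathbf M$ such that, for every Borel set (specification) $\mathcal Z_\phi\subseteq\mathcal Z$, $$\mathbb P_{\bar{\mathbf C}\times\bar{\mathbf M}}(\mathcal Z_\phi)=\mathbb P_{\mathbf C\times\mathbf M}(\mathcal Z_\phi).$$ -/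

import Mathlib

open MeasureTheory ProbabilityTheory

/-- A discrete-time linear Gaussian stochastic control system with state in `ℝⁿ`, input in `ℝᵐ`,
output in `ℝᵖ` and noise in `ℝᵈ`:
`x(t+1) = A x(t) + B u(t) + G e(t)`, `z(t) = H x(t)`, where `x(0) ∼ 𝒩(μ₀, S₀)` and
`e(0), e(1), …` are i.i.d. with law `𝒩(0, W)`, independent of `x(0)`. -/
structure LinearGaussianSystem (n m p d : ℕ) where
  A : Matrix (Fin n) (Fin n) ℝ
  B : Matrix (Fin n) (Fin m) ℝ
  G : Matrix (Fin n) (Fin d) ℝ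
  H : Matrix (Fin p) (Fin n) ℝ
  μ₀ : EuclideanSpace ℝ (Fin n)
  S₀ : Matrix (Fin n) (Fin n) ℝ
  W : Matrix (Fin d) (Fin d) ℝ

/-- Histories `x(0) u(0) x(1) u(1) … x(t-1) u(t-1) x(t)` of length `t`, with states in `ℝⁿ` and
inputs in the input set `U ⊆ ℝᵐ`. The first component lists the pairs `(x(k), u(k))`, `k < t`;
the second is the current state `x(t)`. -/
abbrev History (n : ℕ) {m : ℕ} (U : Set (EuclideanSpace ℝ (Fin m))) (t : ℕ) : Type :=
  (Fin t → EuclideanSpace ℝ (Fin n) × U) × EuclideanSpace ℝ (Fin n)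

/-- A controller: a sequence of (Borel measurable) policies, the `t`-th of which maps the
available history at time `t` to an input in `U`. -/
structure Controller (n : ℕ) {m : ℕ} (U : Set (EuclideanSpace ℝ (Fin m))) where
  policy : (t : ℕ) → History n U t → U
  measurable_policy : ∀ t, Measurable (policy t)

namespace LinearGaussianSystem

variable {n m p d : ℕ} {U : Set (EuclideanSpace ℝ (Fin m))}

/-- The execution up to time `t` of the controlled system, as a function of the initial state
and of the noise sequence. -/
noncomputable def execution (M : LinearGaussianSystem n m p d) (c : Controller n U)
    (ω : EuclideanSpace ℝ (Fin n) × (ℕ → EuclideanSpace ℝ (Fin d))) : (t : ℕ) → History n U t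
  | 0 => (Fin.elim0, ω.1)
  | t + 1 =>
    let h := execution M c ω t
    let u := c.policy t h
    (Fin.snoc (α := fun _ => EuclideanSpace ℝ (Fin n) × U) h.1 (h.2, u),
      M.A.toEuclideanLin h.2 + M.B.toEuclideanLin u + M.G.toEuclideanLin (ω.2 t))

/-- The output trajectory `z(0) z(1) z(2) …` of the controlled system, `z(t) = H x(t)`. -/
noncomputable def output (M : LinearGaussianSystem n m p d) (c : Controller n U)
    (ω : EuclideanSpace ℝ (Fin n) × (ℕ → EuclideanSpace ℝ (Fin d))) :
    ℕ → EuclideanSpace ℝ (Fin p) :=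
  fun t => M.H.toEuclideanLin (M.execution c ω t).2

/-- The joint law of the initial state and of the noise sequence. -/
noncomputable def drivingLaw (M : LinearGaussianSystem n m p d) :
    Measure (EuclideanSpace ℝ (Fin n) × (ℕ → EuclideanSpace ℝ (Fin d))) :=
  (multivariateGaussian M.μ₀ M.S₀).prod
    (Measure.infinitePi fun _ : ℕ => multivariateGaussian 0 M.W)

/-- The probability distribution of the output trajectories of the controlled system. -/
noncomputable def outputLaw (M : LinearGaussianSystem n m p d) (c : Controller n U) :
    Measure (ℕ → EuclideanSpace ℝ (Fin p)) :=
  M.drivingLaw.map (M.output c)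

theorem measurable_execution (M : LinearGaussianSystem n m p d) (c : Controller n U) (t : ℕ) :
    Measurable fun ω => M.execution c ω t := by
  induction t with
  | zero => exact measurable_const.prodMk measurable_fst
  | succ t ih =>
    have hu : Measurable fun ω => c.policy t (M.execution c ω t) :=
      (c.measurable_policy t).comp ih
    have hA : Measurable (M.A.toEuclideanLin) :=
      (LinearMap.continuous_of_finiteDimensional _).measurable
    have hB : Measurable (M.B.toEuclideanLin) :=
      (LinearMap.continuous_of_finiteDimensional _).measurable
    have hG : Measurable (M.G.toEuclideanLin) :=
      (LinearMap.continuous_of_finiteDimensional _).measurable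
    refine Measurable.prodMk (measurable_pi_lambda _ fun i => ?_) ?_
    · refine Fin.lastCases ?_ (fun j => ?_) i
      · simpa only [execution, Fin.snoc_last] using
          Measurable.prodMk (f := fun ω => (M.execution c ω t).2) (measurable_snd.comp ih) hu
      · have h : Measurable fun ω => (M.execution c ω t).1 j :=
          (measurable_pi_apply j).comp (measurable_fst.comp ih)
        simpa only [execution, Fin.snoc_castSucc] using h
    · exact ((hA.comp (measurable_snd.comp ih)).add
        (hB.comp (measurable_subtype_coe.comp hu))).add
        (hG.comp ((measurable_pi_apply t).comp measurable_snd))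

theorem measurable_output (M : LinearGaussianSystem n m p d) (c : Controller n U) :
    Measurable (M.output c) :=
  measurable_pi_lambda _ fun t =>
    (LinearMap.continuous_of_finiteDimensional (M.H.toEuclideanLin)).measurable.comp
      (measurable_snd.comp (M.measurable_execution c t))

instance isProbabilityMeasure_outputLaw (M : LinearGaussianSystem n m p d)
    (c : Controller n U) : IsProbabilityMeasure (M.outputLaw c) := by
  have : IsProbabilityMeasure M.drivingLaw := by
    unfold drivingLaw
    infer_instance
  exact Measure.isProbabilityMeasure_map (M.measurable_output c).aemeasurable

end LinearGaussianSystem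

/-- The original model: `x(t+1) = A x(t) + B u(t) + w(t)`, `z(t) = H x(t)`, with
`x(0) ∼ 𝒩(μ₀, Σ₀)` and `w(t) ∼ 𝒩(0, Q)`. -/
def originalModel {n m p : ℕ} (A : Matrix (Fin n) (Fin n) ℝ) (B : Matrix (Fin n) (Fin m) ℝ)
    (H : Matrix (Fin p) (Fin n) ℝ) (μ₀ : EuclideanSpace ℝ (Fin n))
    (Sig₀ Q : Matrix (Fin n) (Fin n) ℝ) : LinearGaussianSystem n m p n where
  A := A
  B := B
  G := 1
  H := H
  μ₀ := μ₀
  S₀ := Sig₀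
  W := Q

/-- The Kalman gain `K = X Cᵀ (C X Cᵀ)⁻¹`. -/
noncomputable def kalmanGain {n q : ℕ} (C : Matrix (Fin q) (Fin n) ℝ)
    (X : Matrix (Fin n) (Fin n) ℝ) : Matrix (Fin n) (Fin q) ℝ :=
  X * C.transpose * (C * X * C.transpose)⁻¹

/-- The time-invariant abstract model with constant gain `K = X Cᵀ (C X Cᵀ)⁻¹`:
`x(t+1) = A x(t) + B u(t) + K v(t+1)`, `z(t) = H x(t)`, with `x(0) ∼ 𝒩(μ₀, X - P)`,
`P = X - K C X`, and `v(t) ∼ 𝒩(0, C X Cᵀ)`. The noise `e(t)` of `LinearGaussianSystem` is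
`v(t+1)`. -/
noncomputable def abstractModel {n m p q : ℕ} (A : Matrix (Fin n) (Fin n) ℝ)
    (B : Matrix (Fin n) (Fin m) ℝ) (H : Matrix (Fin p) (Fin n) ℝ) (C : Matrix (Fin q) (Fin n) ℝ)
    (μ₀ : EuclideanSpace ℝ (Fin n)) (X : Matrix (Fin n) (Fin n) ℝ) :
    LinearGaussianSystem n m p q where
  A := A
  B := B
  G := kalmanGain C X
  H := H
  μ₀ := μ₀
  S₀ := X - (X - kalmanGain C X * C * X)
  W := C * X * C.transpose

/-- `X` solves the discrete-time algebraic Riccati equation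
`X = A X Aᵀ - A X Cᵀ (C X Cᵀ)⁻¹ C X Aᵀ + Q`. -/
def SolvesDARE {n q : ℕ} (A : Matrix (Fin n) (Fin n) ℝ) (C : Matrix (Fin q) (Fin n) ℝ)
    (Q X : Matrix (Fin n) (Fin n) ℝ) : Prop :=
  X = A * X * A.transpose
    - A * X * C.transpose * (C * X * C.transpose)⁻¹ * C * X * A.transpose + Q

/-- (Discrete-time) stability of a real matrix: all complex eigenvalues lie in the open unit
disc. -/
def IsSchurStable {n : ℕ} (F : Matrix (Fin n) (Fin n) ℝ) : Prop :=
  ∀ z ∈ spectrum ℂ (F.map (algebraMap ℝ ℂ)), ‖z‖ < 1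

/-- `X ≻ 0` is a stabilizing solution of the DARE: `A - F C` is stable for
`F = A X Cᵀ (C X Cᵀ)⁻¹`. -/
def IsStabilizingDARESolution {n q : ℕ} (A : Matrix (Fin n) (Fin n) ℝ)
    (C : Matrix (Fin q) (Fin n) ℝ) (Q X : Matrix (Fin n) (Fin n) ℝ) : Prop :=
  X.PosDef ∧ SolvesDARE A C Q X ∧
    IsSchurStable (A - A * X * C.transpose * (C * X * C.transpose)⁻¹ * C)

/-! The controller for the original model runs a Kalman filter on the noiseless measurement `C x`
and feeds its estimates to the given controller. Two facts make this work. Pathwise: writing the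
state as estimate plus error, the input cancels from the error recursion, and the estimate obeys the
abstract model driven by the innovations `C (A e(t) + w(t))` (`kalmanFilter_execution`). Since `C K
= 1`, each correction leaves an error with `C e = 0`, so `H e = N C e = 0` and the two outputs
coincide. In law: by the DARE, an error of covariance `P` is predicted to covariance `X`; the
correction splits this Gaussian into an innovation and a new error of covariance `P`, which are
uncorrelated, hence independent. So each innovation is independent of the next error and the future
noise, whose joint law is unchanged (`map_innovation_errorStep`), and iteration makes the
innovations i.i.d. The same split at time zero gives the law of the initial estimate, independent of
them (`map_filteredNoise`). -/

/-! ### I.i.d. sequences from a measure-preserving step. -/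

section SequenceLaws

variable {F Ω : Type*} [MeasurableSpace F] [MeasurableSpace Ω]

/-- A law on sequences is the i.i.d. product as soon as it agrees with it on the initial boxes. -/
theorem eq_infinitePi_of_initial_boxes (W : Measure F) [IsProbabilityMeasure W]
    (ν : Measure (ℕ → F))
    (h : ∀ N : ℕ, ∀ s : ℕ → Set F, (∀ i, MeasurableSet (s i)) →
      ν {x | ∀ i < N, x i ∈ s i} = ∏ i ∈ Finset.range N, W (s i)) :
    ν = Measure.infinitePi fun _ : ℕ => W := by
  classical
  refine Measure.eq_infinitePi _ fun I s hs => ?_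
  obtain ⟨N, hN⟩ : ∃ N, I ⊆ Finset.range N := I.exists_nat_subset_range
  -- Coordinates outside `I` are padded by `univ`, which contributes a factor 1.
  have h' := h N (fun i => if i ∈ I then s i else Set.univ) fun i => by
    split_ifs
    exacts [hs i, .univ]
  have hset : {x : ℕ → F | ∀ i < N, x i ∈ (if i ∈ I then s i else Set.univ)}
      = (I : Set ℕ).pi s := by
    ext x
    simp only [Set.mem_ofPred_eq, Set.mem_pi, Finset.mem_coe]
    refine ⟨fun hx i hi => ?_, fun hx i _ => ?_⟩
    · simpa [hi] using hx i (Finset.mem_range.1 (hN hi))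
    · split_ifs with hi
      exacts [hx i hi, trivial]
  rw [← hset, h', ← Finset.prod_subset hN]
  · exact Finset.prod_congr rfl fun i hi => by simp [hi]
  · intro i _ hi
    simp [hi]

/-- The head and the tail of an i.i.d. sequence are independent, and the tail has the law of the
whole sequence. -/
theorem map_head_tail_infinitePi (W : Measure F) [IsProbabilityMeasure W] :
    (Measure.infinitePi fun _ : ℕ => W).map (fun x => (x 0, fun i => x (i + 1)))
      = W.prod (Measure.infinitePi fun _ : ℕ => W) := by
  -- Going through the inverse map puts the unknown law on sequences, where initial boxes suffice.
  let cons : F × (ℕ → F) → ℕ → F := fun a i => Nat.casesOn i a.1 a.2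
  have hcons : Measurable cons := measurable_pi_lambda _ fun i => by
    cases i with
    | zero => exact measurable_fst
    | succ i => exact (measurable_pi_apply i).comp measurable_snd
  have key : (W.prod (Measure.infinitePi fun _ : ℕ => W)).map cons
      = Measure.infinitePi fun _ : ℕ => W := by
    refine eq_infinitePi_of_initial_boxes W _ fun N s hs => ?_
    have hm : MeasurableSet {x : ℕ → F | ∀ i < N, x i ∈ s i} := by
      measurability
    rw [Measure.map_apply hcons hm]
    cases N with
    | zero => simp
    | succ N =>
      have hset : cons ⁻¹' {x | ∀ i < N + 1, x i ∈ s i}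
          = s 0 ×ˢ (Finset.range N : Set ℕ).pi fun i => s (i + 1) := by
        ext a
        simp only [Set.mem_preimage, Set.mem_ofPred_eq, Set.mem_prod, Set.mem_pi,
          Finset.mem_coe, Finset.mem_range]
        refine ⟨fun ha => ⟨ha 0 N.succ_pos, fun i hi => ha (i + 1) (by lia)⟩, fun ha i hi => ?_⟩
        cases i with
        | zero => exact ha.1
        | succ i => exact ha.2 i (by lia)
      rw [hset, Measure.prod_prod, Measure.infinitePi_pi _ fun i _ => hs _,
        Finset.prod_range_succ', mul_comm]
  conv_lhs => rw [← key]
  rw [Measure.map_map (by fun_prop) hcons]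
  exact Measure.map_id

/-- If `f` and `T` are independent under `ν`, with `f ∼ W` and `T` preserving `ν`, then the
observations `f, f ∘ T, f ∘ T², …` are i.i.d. with law `W`. -/
theorem map_observations_eq_infinitePi {ν : Measure Ω} [IsProbabilityMeasure ν] {W : Measure F}
    [IsProbabilityMeasure W] {T : Ω → Ω} {f : Ω → F} (hT : Measurable T) (hf : Measurable f)
    (h : ν.map (fun ω => (f ω, T ω)) = W.prod ν) :
    ν.map (fun ω (t : ℕ) => f (T^[t] ω)) = Measure.infinitePi fun _ : ℕ => W := by
  have hobs : Measurable fun ω (t : ℕ) => f (T^[t] ω) :=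
    measurable_pi_lambda _ fun t => hf.comp (hT.iterate t)
  have hbox : ∀ (N : ℕ) (s : ℕ → Set F), (∀ i, MeasurableSet (s i)) →
      MeasurableSet {x : ℕ → F | ∀ i < N, x i ∈ s i} := by
    intro N s hs
    measurability
  refine eq_infinitePi_of_initial_boxes W _ fun N => ?_
  induction N with
  | zero =>
    intro s hs
    rw [Measure.map_apply hobs (hbox _ s hs)]
    simp
  | succ N ih =>
    intro s hs
    -- The box is shifted here, so the induction must keep `s` arbitrary.
    have ih' := ih (fun i => s (i + 1)) fun i => hs _
    rw [Measure.map_apply hobs (hbox _ _ fun i => hs _)] at ih'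
    have hset : (fun ω (t : ℕ) => f (T^[t] ω)) ⁻¹' {x | ∀ i < N + 1, x i ∈ s i}
        = (fun ω => (f ω, T ω)) ⁻¹' (s 0 ×ˢ
          ((fun ω (t : ℕ) => f (T^[t] ω)) ⁻¹' {x | ∀ i < N, x i ∈ s (i + 1)})) := by
      ext ω
      simp only [Set.mem_preimage, Set.mem_ofPred_eq, Set.mem_prod]
      refine ⟨fun ha => ⟨ha 0 N.succ_pos, fun i hi => ha (i + 1) (by lia)⟩, fun ha i hi => ?_⟩
      cases i with
      | zero => exact ha.1
      | succ i => exact ha.2 i (by lia)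
    rw [Measure.map_apply hobs (hbox _ s hs), hset,
      ← Measure.map_apply (hf.prodMk hT) ((hs 0).prod (hobs (hbox _ _ fun i => hs _))), h,
      Measure.prod_prod, ih', Finset.prod_range_succ', mul_comm]

end SequenceLaws

/-! ### Pushforwards in one factor of a product. -/

section ProductMaps

variable {α β γ : Type*} [MeasurableSpace α] [MeasurableSpace β] [MeasurableSpace γ]

theorem map_prod_eq_map_prodMk (μ : Measure α) (ν : Measure γ) [IsFiniteMeasure μ]
    [IsFiniteMeasure ν] {f : α → β} (hf : Measurable f) :
    (μ.map f).prod ν = (μ.prod ν).map (fun a => (f a.1, a.2)) := by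
  have h := Measure.map_prod_map μ ν hf measurable_id
  rwa [Measure.map_id] at h

theorem prod_map_eq_map_prodMk (μ : Measure α) (ν : Measure β) [IsFiniteMeasure μ]
    [IsFiniteMeasure ν] {f : β → γ} (hf : Measurable f) :
    μ.prod (ν.map f) = (μ.prod ν).map (fun a => (a.1, f a.2)) := by
  have h := Measure.map_prod_map μ ν measurable_id hf
  rwa [Measure.map_id] at h

end ProductMaps

/-! ### Affine images, sums and independence of Gaussian vectors. -/

section GaussianLaws

variable {ι κ θ : Type*} [Fintype ι] [DecidableEq ι] [Fintype κ] [DecidableEq κ]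
  [Fintype θ] [DecidableEq θ]

open scoped RealInnerProductSpace Matrix

theorem Matrix.measurable_toEuclideanLin {κ : Type*} [Fintype κ] (M : Matrix κ ι ℝ) :
    Measurable M.toEuclideanLin :=
  (LinearMap.continuous_of_finiteDimensional _).measurable

theorem Matrix.inner_toEuclideanLin_eq (M : Matrix κ ι ℝ) (x : EuclideanSpace ℝ ι)
    (y : EuclideanSpace ℝ κ) :
    ⟪y, M.toEuclideanLin x⟫ = ⟪(Mᵀ).toEuclideanLin y, x⟫ := by
  rw [← Matrix.conjTranspose_eq_transpose_of_trivial,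
    Matrix.toEuclideanLin_conjTranspose_eq_adjoint, LinearMap.adjoint_inner_left]

/-- An affine image of a Gaussian measure is Gaussian. -/
theorem map_affine_multivariateGaussian (M : Matrix κ ι ℝ) (b : EuclideanSpace ℝ κ)
    (μ : EuclideanSpace ℝ ι) {S : Matrix ι ι ℝ} (hS : S.PosSemidef) :
    (multivariateGaussian μ S).map (fun x => b + M.toEuclideanLin x)
      = multivariateGaussian (b + M.toEuclideanLin μ) (M * S * Mᵀ) := by
  have hM : (M * S * Mᵀ).PosSemidef := by
    simpa using hS.mul_mul_conjTranspose_same M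
  have hmeas := M.measurable_toEuclideanLin
  apply Measure.ext_of_charFun
  ext t
  -- At `t`, the affine image has the characteristic function of the source at `Mᵀ t`, times a phase
  -- from `b`.
  have h := charFun_multivariateGaussian (μ := μ) hS ((Mᵀ).toEuclideanLin t)
  rw [charFun_apply] at h
  rw [charFun_multivariateGaussian hM, charFun_apply, integral_map (by fun_prop) (by fun_prop)]
  have he : ∀ x : EuclideanSpace ℝ ι,
      Complex.exp (⟪b + M.toEuclideanLin x, t⟫ * Complex.I)
        = Complex.exp (⟪t, b⟫ * Complex.I) *
          Complex.exp (⟪x, (Mᵀ).toEuclideanLin t⟫ * Complex.I) := by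
    intro x
    rw [← Complex.exp_add, real_inner_comm, inner_add_right, M.inner_toEuclideanLin_eq,
      real_inner_comm x]
    push_cast
    ring_nf
  simp_rw [he]
  rw [integral_const_mul, h, ← Complex.exp_add, inner_add_right, M.inner_toEuclideanLin_eq]
  congr 1
  have hq : ((Mᵀ).toEuclideanLin t).ofLp ⬝ᵥ S *ᵥ ((Mᵀ).toEuclideanLin t).ofLp
      = t.ofLp ⬝ᵥ (M * S * Mᵀ) *ᵥ t.ofLp := by
    rw [Matrix.ofLp_toLpLin, Matrix.toLin'_apply, ← Matrix.mulVec_mulVec, ← Matrix.mulVec_mulVec,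
      Matrix.dotProduct_mulVec _ M, ← Matrix.mulVec_transpose M]
  rw [hq]
  push_cast
  ring

/-- The sum of independent Gaussian vectors is Gaussian. -/
theorem map_add_multivariateGaussian_prod (μ ν : EuclideanSpace ℝ ι) {S T : Matrix ι ι ℝ}
    (hS : S.PosSemidef) (hT : T.PosSemidef) :
    ((multivariateGaussian μ S).prod (multivariateGaussian ν T)).map (fun p => p.1 + p.2)
      = multivariateGaussian (μ + ν) (S + T) := by
  apply Measure.ext_of_charFun
  rw [charFun_map_add_prod_eq_mul]
  ext t
  rw [Pi.mul_apply, charFun_multivariateGaussian hS, charFun_multivariateGaussian hT,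
    charFun_multivariateGaussian (hS.add hT), ← Complex.exp_add]
  congr 1
  rw [inner_add_right, Matrix.add_mulVec, dotProduct_add]
  push_cast
  ring

/-- Uncorrelated affine images of a Gaussian vector are independent. -/
theorem map_affine_pair_multivariateGaussian (M : Matrix κ ι ℝ) (D : Matrix θ ι ℝ)
    (b : EuclideanSpace ℝ κ) (d : EuclideanSpace ℝ θ) (μ : EuclideanSpace ℝ ι)
    {S : Matrix ι ι ℝ} (hS : S.PosSemidef) (h : M * S * Dᵀ = 0) :
    (multivariateGaussian μ S).map (fun x => (b + M.toEuclideanLin x, d + D.toEuclideanLin x))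
      = (multivariateGaussian (b + M.toEuclideanLin μ) (M * S * Mᵀ)).prod
        (multivariateGaussian (d + D.toEuclideanLin μ) (D * S * Dᵀ)) := by
  have hM := M.measurable_toEuclideanLin
  have hD := D.measurable_toEuclideanLin
  have hlin : IndepFun M.toEuclideanLin D.toEuclideanLin (multivariateGaussian μ S) := by
    apply HasGaussianLaw.indepFun_of_covariance_inner
    -- Uncorrelated implies independent only under joint normality: the pair is one linear image of
    -- a Gaussian.
    · refine ⟨?_⟩
      exact isGaussian_map (L := (M.toEuclideanLin.toContinuousLinearMap).prod
        (D.toEuclideanLin.toContinuousLinearMap))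
    · intro x y
      simp_rw [Matrix.inner_toEuclideanLin_eq]
      rw [← covarianceBilin_apply_eq_cov IsGaussian.memLp_two_id,
        covarianceBilin_multivariateGaussian hS]
      simp only [Matrix.ofLp_toLpLin, Matrix.toLin'_apply]
      rw [Matrix.mulVec_mulVec, Matrix.mulVec_transpose, ← Matrix.dotProduct_mulVec,
        Matrix.mulVec_mulVec, ← Matrix.mul_assoc, h]
      simp
  have hind : IndepFun (fun x => b + M.toEuclideanLin x) (fun x => d + D.toEuclideanLin x)
      (multivariateGaussian μ S) :=
    hlin.comp (measurable_const_add b) (measurable_const_add d)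
  rw [hind.map_prod_eq_prod_map_map (by fun_prop) (by fun_prop),
    map_affine_multivariateGaussian M b μ hS, map_affine_multivariateGaussian D d μ hS]

end GaussianLaws

/-! ### The filter and its pathwise behaviour. -/

section KalmanFilter

variable {n m p q : ℕ} {U : Set (EuclideanSpace ℝ (Fin m))}

/-- The Kalman filter with gain `K` and noiseless measurements `C x`: from a history of states and
inputs it computes the history of state estimates and inputs. -/
noncomputable def kalmanFilter (A : Matrix (Fin n) (Fin n) ℝ) (B : Matrix (Fin n) (Fin m) ℝ)
    (C : Matrix (Fin q) (Fin n) ℝ) (K : Matrix (Fin n) (Fin q) ℝ)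
    (μ₀ : EuclideanSpace ℝ (Fin n)) : (t : ℕ) → History n U t → History n U t
  | 0, h => (Fin.elim0, μ₀ + K.toEuclideanLin (C.toEuclideanLin (h.2 - μ₀)))
  | t + 1, h =>
    -- Forgetting `u(t)` and `x(t+1)` recovers the history at time `t`.
    let e := kalmanFilter A B C K μ₀ t (fun i => h.1 i.castSucc, (h.1 (Fin.last t)).1)
    let u := (h.1 (Fin.last t)).2
    let x := A.toEuclideanLin e.2 + B.toEuclideanLin u
    (Fin.snoc (α := fun _ => EuclideanSpace ℝ (Fin n) × U) e.1 (e.2, u),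
      x + K.toEuclideanLin (C.toEuclideanLin (h.2 - x)))

theorem measurable_kalmanFilter (A : Matrix (Fin n) (Fin n) ℝ) (B : Matrix (Fin n) (Fin m) ℝ)
    (C : Matrix (Fin q) (Fin n) ℝ) (K : Matrix (Fin n) (Fin q) ℝ)
    (μ₀ : EuclideanSpace ℝ (Fin n)) (t : ℕ) :
    Measurable (kalmanFilter (U := U) A B C K μ₀ t) := by
  have hA := A.measurable_toEuclideanLin
  have hB := B.measurable_toEuclideanLin
  have hC := C.measurable_toEuclideanLin
  have hK := K.measurable_toEuclideanLin
  induction t with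
  | zero =>
    refine measurable_const.prodMk ?_
    fun_prop
  | succ t ih =>
    have hp : Measurable fun h : History n U (t + 1) =>
        ((fun i => h.1 i.castSucc, (h.1 (Fin.last t)).1) : History n U t) := by
      fun_prop
    have he : Measurable fun h : History n U (t + 1) => kalmanFilter A B C K μ₀ t
        (fun i => h.1 i.castSucc, (h.1 (Fin.last t)).1) := ih.comp hp
    have hu : Measurable fun h : History n U (t + 1) => (h.1 (Fin.last t)).2 := by
      fun_prop
    have hx : Measurable fun h : History n U (t + 1) =>
        A.toEuclideanLin (kalmanFilter A B C K μ₀ t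
          (fun i => h.1 i.castSucc, (h.1 (Fin.last t)).1)).2
          + B.toEuclideanLin (h.1 (Fin.last t)).2 :=
      (hA.comp (measurable_snd.comp he)).add (hB.comp (measurable_subtype_coe.comp hu))
    refine Measurable.prodMk (measurable_pi_lambda _ fun i => ?_) ?_
    · refine Fin.lastCases ?_ (fun j => ?_) i
      · simpa only [Fin.snoc_last, Function.comp_def] using (measurable_snd.comp he).prodMk hu
      · simpa only [Fin.snoc_castSucc, Function.comp_def] using
          (measurable_pi_apply j).comp (measurable_fst.comp he)
    · exact hx.add (hK.comp (hC.comp (measurable_snd.sub hx)))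

/-- The controller which applies `c` to the state estimates of the Kalman filter. -/
noncomputable def Controller.compKalmanFilter (c : Controller n U) (A : Matrix (Fin n) (Fin n) ℝ)
    (B : Matrix (Fin n) (Fin m) ℝ) (C : Matrix (Fin q) (Fin n) ℝ) (K : Matrix (Fin n) (Fin q) ℝ)
    (μ₀ : EuclideanSpace ℝ (Fin n)) : Controller n U where
  policy t h := c.policy t (kalmanFilter A B C K μ₀ t h)
  measurable_policy t := (c.measurable_policy t).comp (measurable_kalmanFilter A B C K μ₀ t)

/-- The one-step evolution of the estimation error, paired with the shift of the noise. -/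
noncomputable def errorStep (A : Matrix (Fin n) (Fin n) ℝ) (C : Matrix (Fin q) (Fin n) ℝ)
    (K : Matrix (Fin n) (Fin q) ℝ)
    (ω : EuclideanSpace ℝ (Fin n) × (ℕ → EuclideanSpace ℝ (Fin n))) :
    EuclideanSpace ℝ (Fin n) × (ℕ → EuclideanSpace ℝ (Fin n)) :=
  ((1 - K * C).toEuclideanLin (A.toEuclideanLin ω.1 + ω.2 0), fun i => ω.2 (i + 1))

/-- The innovation as a function of the estimation error and of the noise. -/
noncomputable def innovation (A : Matrix (Fin n) (Fin n) ℝ) (C : Matrix (Fin q) (Fin n) ℝ)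
    (ω : EuclideanSpace ℝ (Fin n) × (ℕ → EuclideanSpace ℝ (Fin n))) :
    EuclideanSpace ℝ (Fin q) :=
  C.toEuclideanLin (A.toEuclideanLin ω.1 + ω.2 0)

/-- The initial estimate and the initial estimation error. -/
noncomputable def initialEstimate (C : Matrix (Fin q) (Fin n) ℝ) (K : Matrix (Fin n) (Fin q) ℝ)
    (μ₀ x : EuclideanSpace ℝ (Fin n)) : EuclideanSpace ℝ (Fin n) × EuclideanSpace ℝ (Fin n) :=
  (μ₀ + K.toEuclideanLin (C.toEuclideanLin (x - μ₀)), (1 - K * C).toEuclideanLin (x - μ₀))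

/-- The initial estimate and the innovation process as functions of the initial state and the
noise of the original model. -/
noncomputable def filteredNoise (A : Matrix (Fin n) (Fin n) ℝ) (C : Matrix (Fin q) (Fin n) ℝ)
    (K : Matrix (Fin n) (Fin q) ℝ) (μ₀ : EuclideanSpace ℝ (Fin n))
    (ω : EuclideanSpace ℝ (Fin n) × (ℕ → EuclideanSpace ℝ (Fin n))) :
    EuclideanSpace ℝ (Fin n) × (ℕ → EuclideanSpace ℝ (Fin q)) :=
  ((initialEstimate C K μ₀ ω.1).1,
    fun t => innovation A C ((errorStep A C K)^[t] ((initialEstimate C K μ₀ ω.1).2, ω.2)))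

theorem measurable_errorStep (A : Matrix (Fin n) (Fin n) ℝ) (C : Matrix (Fin q) (Fin n) ℝ)
    (K : Matrix (Fin n) (Fin q) ℝ) : Measurable (errorStep A C K) := by
  have hA := A.measurable_toEuclideanLin
  have hD := (1 - K * C).measurable_toEuclideanLin
  unfold errorStep
  fun_prop

theorem measurable_innovation (A : Matrix (Fin n) (Fin n) ℝ) (C : Matrix (Fin q) (Fin n) ℝ) :
    Measurable (innovation A C) := by
  have hA := A.measurable_toEuclideanLin
  have hC := C.measurable_toEuclideanLin
  unfold innovation
  fun_prop

theorem measurable_initialEstimate (C : Matrix (Fin q) (Fin n) ℝ) (K : Matrix (Fin n) (Fin q) ℝ)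
    (μ₀ : EuclideanSpace ℝ (Fin n)) : Measurable (initialEstimate C K μ₀) := by
  have hC := C.measurable_toEuclideanLin
  have hK := K.measurable_toEuclideanLin
  have hD := (1 - K * C).measurable_toEuclideanLin
  unfold initialEstimate
  fun_prop

/-- Only `i = 0` is used later, to identify the noise at step `t` as `w(t)`; the induction needs
every `i`. -/
theorem errorStep_iterate_snd (A : Matrix (Fin n) (Fin n) ℝ) (C : Matrix (Fin q) (Fin n) ℝ)
    (K : Matrix (Fin n) (Fin q) ℝ) (t : ℕ)
    (ω : EuclideanSpace ℝ (Fin n) × (ℕ → EuclideanSpace ℝ (Fin n))) (i : ℕ) :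
    ((errorStep A C K)^[t] ω).2 i = ω.2 (t + i) := by
  induction t generalizing i with
  | zero => simp
  | succ t ih =>
    rw [Function.iterate_succ_apply']
    exact (ih (i + 1)).trans (congrArg ω.2 (by lia))

theorem one_sub_mul_toEuclideanLin_apply (C : Matrix (Fin q) (Fin n) ℝ)
    (K : Matrix (Fin n) (Fin q) ℝ) (x : EuclideanSpace ℝ (Fin n)) :
    (1 - K * C).toEuclideanLin x = x - K.toEuclideanLin (C.toEuclideanLin x) := by
  rw [map_sub, Matrix.toLpLin_one, Matrix.toLpLin_mul_same]
  rfl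

/-- A correction step reproduces the noiseless measurement exactly. -/
theorem toEuclideanLin_comp_one_sub_mul_eq_zero {C : Matrix (Fin q) (Fin n) ℝ}
    {K : Matrix (Fin n) (Fin q) ℝ} (hCK : C * K = 1) (x : EuclideanSpace ℝ (Fin n)) :
    C.toEuclideanLin ((1 - K * C).toEuclideanLin x) = 0 := by
  have h : C * (1 - K * C) = 0 := by
    rw [Matrix.mul_sub, Matrix.mul_one, ← Matrix.mul_assoc, hCK, Matrix.one_mul, sub_self]
  have h' := Matrix.toLpLin_mul_same 2 C (1 - K * C)
  rw [h, map_zero] at h'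
  exact (LinearMap.congr_fun h' x).symm

/-- Along executions of the original model, the filtered history is the execution of the abstract
model driven by the innovations, and the state is the sum of its estimate and of the error. -/
theorem kalmanFilter_execution (A : Matrix (Fin n) (Fin n) ℝ) (B : Matrix (Fin n) (Fin m) ℝ)
    (H : Matrix (Fin p) (Fin n) ℝ) (C : Matrix (Fin q) (Fin n) ℝ)
    (μ₀ : EuclideanSpace ℝ (Fin n)) (X Q : Matrix (Fin n) (Fin n) ℝ) (c : Controller n U)
    (ω : EuclideanSpace ℝ (Fin n) × (ℕ → EuclideanSpace ℝ (Fin n))) (t : ℕ) :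
    kalmanFilter A B C (kalmanGain C X) μ₀ t ((originalModel A B H μ₀ X Q).execution
        (c.compKalmanFilter A B C (kalmanGain C X) μ₀) ω t)
      = (abstractModel A B H C μ₀ X).execution c
        (filteredNoise A C (kalmanGain C X) μ₀ ω) t ∧
    ((originalModel A B H μ₀ X Q).execution
        (c.compKalmanFilter A B C (kalmanGain C X) μ₀) ω t).2
      = ((abstractModel A B H C μ₀ X).execution c
          (filteredNoise A C (kalmanGain C X) μ₀ ω) t).2
        + ((errorStep A C (kalmanGain C X))^[t]
          ((initialEstimate C (kalmanGain C X) μ₀ ω.1).2, ω.2)).1 := by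
  induction t with
  | zero =>
    refine ⟨rfl, ?_⟩
    simp only [LinearGaussianSystem.execution, filteredNoise, initialEstimate,
      Function.iterate_zero, id, one_sub_mul_toEuclideanLin_apply]
    abel
  | succ t ih =>
    obtain ⟨ih₁, ih₂⟩ := ih
    have hw := errorStep_iterate_snd A C (kalmanGain C X) t
      ((initialEstimate C (kalmanGain C X) μ₀ ω.1).2, ω.2) 0
    rw [Function.iterate_succ_apply']
    simp only [LinearGaussianSystem.execution, kalmanFilter, Fin.snoc_last, Fin.snoc_castSucc]
    -- Equal filtered histories yield equal inputs, so `B u` drops out of the error.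
    have hu : (c.compKalmanFilter A B C (kalmanGain C X) μ₀).policy t
        ((originalModel A B H μ₀ X Q).execution
          (c.compKalmanFilter A B C (kalmanGain C X) μ₀) ω t)
        = c.policy t ((abstractModel A B H C μ₀ X).execution c
          (filteredNoise A C (kalmanGain C X) μ₀ ω) t) := congrArg (c.policy t) ih₁
    rw [hu, ih₁, ih₂]
    generalize (abstractModel A B H C μ₀ X).execution c
      (filteredNoise A C (kalmanGain C X) μ₀ ω) t = e
    simp only [originalModel, abstractModel, filteredNoise, innovation, errorStep,
      Matrix.toLpLin_one, LinearMap.id_apply, one_sub_mul_toEuclideanLin_apply, hw, map_add,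
      add_zero]
    refine ⟨Prod.ext rfl ?_, ?_⟩
    · simp only [map_add, map_sub]
      abel
    · abel

end KalmanFilter

/-! ### Covariance identities for the gain. -/

section Covariances

variable {n q : ℕ} {C : Matrix (Fin q) (Fin n) ℝ} {X : Matrix (Fin n) (Fin n) ℝ}

/-- The normal equations of the gain, the source of the orthogonality below. -/
theorem kalmanGain_mul_innovationCovariance (hC : (C * X * C.transpose).PosDef) :
    kalmanGain C X * (C * X * C.transpose) = X * C.transpose := by
  rw [kalmanGain, Matrix.mul_assoc _ _⁻¹,
    Matrix.nonsing_inv_mul _ ((Matrix.isUnit_iff_isUnit_det _).1 hC.isUnit), Matrix.mul_one]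

theorem mul_kalmanGain (hC : (C * X * C.transpose).PosDef) : C * kalmanGain C X = 1 := by
  rw [kalmanGain, ← Matrix.mul_assoc, ← Matrix.mul_assoc,
    Matrix.mul_nonsing_inv _ ((Matrix.isUnit_iff_isUnit_det _).1 hC.isUnit)]

theorem innovationCovariance_mul_kalmanGain_transpose (hX : X.PosDef)
    (hC : (C * X * C.transpose).PosDef) :
    C * X * C.transpose * (kalmanGain C X).transpose = C * X := by
  have hXt : X.transpose = X := by simpa using hX.isHermitian.eq
  have h := congrArg Matrix.transpose (kalmanGain_mul_innovationCovariance hC)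
  simpa [Matrix.transpose_mul, hXt, Matrix.mul_assoc] using h

/-- The innovation and the estimation error are uncorrelated. -/
theorem innovation_error_uncorrelated (hX : X.PosDef) (hC : (C * X * C.transpose).PosDef) :
    C * X * (1 - kalmanGain C X * C).transpose = 0 := by
  rw [Matrix.transpose_sub, Matrix.transpose_one, Matrix.transpose_mul, Matrix.mul_sub,
    Matrix.mul_one, ← Matrix.mul_assoc, innovationCovariance_mul_kalmanGain_transpose hX hC,
    sub_self]

/-- Orthogonality kills the `K C` part of the left factor; then `X (K C)ᵀ = K C X`, as both equal `K
(C X Cᵀ) Kᵀ`. -/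
theorem error_covariance (hX : X.PosDef) (hC : (C * X * C.transpose).PosDef) :
    (1 - kalmanGain C X * C) * X * (1 - kalmanGain C X * C).transpose
      = X - kalmanGain C X * C * X := by
  have h : kalmanGain C X * C * X * (1 - kalmanGain C X * C).transpose = 0 := by
    rw [Matrix.mul_assoc _ C, Matrix.mul_assoc, innovation_error_uncorrelated hX hC,
      Matrix.mul_zero]
  have h' : X * (C.transpose * (kalmanGain C X).transpose) = kalmanGain C X * C * X := by
    rw [← Matrix.mul_assoc, ← kalmanGain_mul_innovationCovariance hC, Matrix.mul_assoc,
      innovationCovariance_mul_kalmanGain_transpose hX hC, Matrix.mul_assoc]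
  rw [Matrix.sub_mul, Matrix.sub_mul, h, sub_zero, Matrix.one_mul, Matrix.transpose_sub,
    Matrix.transpose_one, Matrix.transpose_mul, Matrix.mul_sub, Matrix.mul_one, h']

theorem estimate_covariance (hX : X.PosDef) (hC : (C * X * C.transpose).PosDef) :
    kalmanGain C X * C * X * (kalmanGain C X * C).transpose
      = X - (X - kalmanGain C X * C * X) := by
  rw [Matrix.transpose_mul, ← Matrix.mul_assoc, sub_sub_cancel, Matrix.mul_assoc _ C X,
    Matrix.mul_assoc _ (C * X), Matrix.mul_assoc,
    innovationCovariance_mul_kalmanGain_transpose hX hC]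

theorem posSemidef_error_covariance (hX : X.PosDef) (hC : (C * X * C.transpose).PosDef) :
    (X - kalmanGain C X * C * X).PosSemidef := by
  rw [← error_covariance hX hC]
  rw [← Matrix.conjTranspose_eq_transpose_of_trivial]
  exact hX.posSemidef.mul_mul_conjTranspose_same _

/-- The DARE says that the prediction error covariance is stationary. -/
theorem SolvesDARE.prediction_covariance {A Q : Matrix (Fin n) (Fin n) ℝ}
    (h : SolvesDARE A C Q X) :
    A * (X - kalmanGain C X * C * X) * A.transpose + Q = X := by
  -- `X` occurs on both sides; only the right one is to be expanded.
  conv_rhs => rw [h]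
  simp only [kalmanGain, Matrix.mul_sub, Matrix.sub_mul, Matrix.mul_assoc]

end Covariances

/-! ### Joint law of the initial estimate and the innovations. -/

section Laws

variable {n q : ℕ} {C : Matrix (Fin q) (Fin n) ℝ} {X : Matrix (Fin n) (Fin n) ℝ}

/-- Orthogonality splits the prior into independent parts; the error starts in its stationary law.
-/
theorem map_initialEstimate (hX : X.PosDef) (hC : (C * X * C.transpose).PosDef)
    (μ₀ : EuclideanSpace ℝ (Fin n)) :
    (multivariateGaussian μ₀ X).map (initialEstimate C (kalmanGain C X) μ₀)
      = (multivariateGaussian μ₀ (X - (X - kalmanGain C X * C * X))).prod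
        (multivariateGaussian 0 (X - kalmanGain C X * C * X)) := by
  have h := map_affine_pair_multivariateGaussian (kalmanGain C X * C) (1 - kalmanGain C X * C)
    (μ₀ - (kalmanGain C X * C).toEuclideanLin μ₀) (-(1 - kalmanGain C X * C).toEuclideanLin μ₀)
    μ₀ hX.posSemidef (by rw [Matrix.mul_assoc _ C, Matrix.mul_assoc,
      innovation_error_uncorrelated hX hC, Matrix.mul_zero])
  rw [estimate_covariance hX hC, error_covariance hX hC, sub_add_cancel, neg_add_cancel] at h
  rw [← h]
  congr 1
  funext x
  refine Prod.ext ?_ ?_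
  · have hKC : ∀ y, (kalmanGain C X * C).toEuclideanLin y
        = (kalmanGain C X).toEuclideanLin (C.toEuclideanLin y) := fun y => by
      rw [Matrix.toLpLin_mul_same]
      rfl
    simp only [initialEstimate, map_sub, hKC]
    abel
  · simp only [initialEstimate, map_sub (Matrix.toEuclideanLin _)]
    abel

/-- The innovation is independent of the next error and of the future noise, and the law of the
latter two is stationary. -/
theorem map_innovation_errorStep {A Q : Matrix (Fin n) (Fin n) ℝ} (hQ : Q.PosSemidef)
    (hX : X.PosDef) (hD : SolvesDARE A C Q X) (hC : (C * X * C.transpose).PosDef) :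
    ((multivariateGaussian 0 (X - kalmanGain C X * C * X)).prod
        (Measure.infinitePi fun _ : ℕ => multivariateGaussian 0 Q)).map
        (fun ω => (innovation A C ω, errorStep A C (kalmanGain C X) ω))
      = (multivariateGaussian 0 (C * X * C.transpose)).prod
        ((multivariateGaussian 0 (X - kalmanGain C X * C * X)).prod
          (Measure.infinitePi fun _ : ℕ => multivariateGaussian 0 Q)) := by
  set P := X - kalmanGain C X * C * X with hPdef
  set D := 1 - kalmanGain C X * C with hDdef
  have hP : P.PosSemidef := posSemidef_error_covariance hX hC
  have hAm := A.measurable_toEuclideanLin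
  have hCm := C.measurable_toEuclideanLin
  have hDm := D.measurable_toEuclideanLin
  -- The prediction error `A e + w` has covariance `A P Aᵀ + Q = X`.
  have hsum : ((multivariateGaussian 0 P).prod (multivariateGaussian 0 Q)).map
      (fun a => A.toEuclideanLin a.1 + a.2) = multivariateGaussian 0 X := by
    have hA := map_affine_multivariateGaussian A 0 0 hP
    simp only [zero_add, map_zero] at hA
    have hadd := map_add_multivariateGaussian_prod (0 : EuclideanSpace ℝ (Fin n)) 0
      (by simpa using hP.mul_mul_conjTranspose_same A : (A * P * A.transpose).PosSemidef) hQ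
    rw [hD.prediction_covariance, add_zero, ← hA] at hadd
    rw [map_prod_eq_map_prodMk _ _ hAm, Measure.map_map (by fun_prop) (by fun_prop)]
      at hadd
    exact hadd
  have hpair : (multivariateGaussian 0 X).map
      (fun x => (C.toEuclideanLin x, D.toEuclideanLin x))
      = (multivariateGaussian 0 (C * X * C.transpose)).prod (multivariateGaussian 0 P) := by
    have h := map_affine_pair_multivariateGaussian C D 0 0 0 hX.posSemidef
      (innovation_error_uncorrelated hX hC)
    simp only [zero_add, map_zero] at h
    rw [h, error_covariance hX hC]
  set I := Measure.infinitePi fun _ : ℕ => multivariateGaussian (0 : EuclideanSpace ℝ (Fin n)) Q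
    with hI
  have hstep : ((multivariateGaussian 0 P).prod (multivariateGaussian 0 Q)).map
      (fun a => (C.toEuclideanLin (A.toEuclideanLin a.1 + a.2),
        D.toEuclideanLin (A.toEuclideanLin a.1 + a.2)))
      = (multivariateGaussian 0 (C * X * C.transpose)).prod (multivariateGaussian 0 P) := by
    rw [← hpair, ← hsum, Measure.map_map (by fun_prop) (by fun_prop)]
    rfl
  have hhead := map_head_tail_infinitePi
    (multivariateGaussian (0 : EuclideanSpace ℝ (Fin n)) Q)
  rw [← hI] at hhead
  -- The head `w(0)` joins the error; the tail remains as independent future noise.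
  have h1 : ((multivariateGaussian 0 P).prod I).map
      (fun ω => ((ω.1, ω.2 0), fun i => ω.2 (i + 1)))
      = ((multivariateGaussian 0 P).prod (multivariateGaussian 0 Q)).prod I := by
    rw [← (measurePreserving_prodAssoc _ _ _).symm.map_eq, ← hhead]
    rw [prod_map_eq_map_prodMk _ _ (by fun_prop),
      Measure.map_map (by fun_prop) (by fun_prop)]
    rfl
  rw [← (measurePreserving_prodAssoc _ _ _).map_eq, ← hstep]
  rw [map_prod_eq_map_prodMk _ _ (by fun_prop), ← h1,
    Measure.map_map (by fun_prop) (by fun_prop), Measure.map_map (by fun_prop) (by fun_prop)]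
  rfl

variable {m p : ℕ}

/-- The initial estimate and the innovations have the joint law which drives the abstract
model. -/
theorem map_filteredNoise {A Q : Matrix (Fin n) (Fin n) ℝ} (B : Matrix (Fin n) (Fin m) ℝ)
    (H : Matrix (Fin p) (Fin n) ℝ) (μ₀ : EuclideanSpace ℝ (Fin n)) (hQ : Q.PosSemidef)
    (hX : X.PosDef) (hD : SolvesDARE A C Q X) (hC : (C * X * C.transpose).PosDef) :
    (originalModel A B H μ₀ X Q).drivingLaw.map (filteredNoise A C (kalmanGain C X) μ₀)
      = (abstractModel A B H C μ₀ X).drivingLaw := by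
  have hE := measurable_errorStep A C (kalmanGain C X)
  have hV := measurable_innovation A C
  have hI := measurable_initialEstimate C (kalmanGain C X) μ₀
  have hobs := map_observations_eq_infinitePi hE hV (map_innovation_errorStep hQ hX hD hC)
  have hobsm : Measurable fun ω (t : ℕ) =>
      innovation A C ((errorStep A C (kalmanGain C X))^[t] ω) :=
    measurable_pi_lambda _ fun t => hV.comp (hE.iterate t)
  simp only [LinearGaussianSystem.drivingLaw, originalModel, abstractModel]
  rw [← hobs, prod_map_eq_map_prodMk _ _ hobsm,
    ← (measurePreserving_prodAssoc _ _ _).map_eq, ← map_initialEstimate hX hC μ₀,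
    map_prod_eq_map_prodMk _ _ hI, Measure.map_map (by fun_prop) (by fun_prop),
    Measure.map_map (by fun_prop) (by fun_prop)]
  rfl

theorem measurable_filteredNoise (A : Matrix (Fin n) (Fin n) ℝ) (C : Matrix (Fin q) (Fin n) ℝ)
    (K : Matrix (Fin n) (Fin q) ℝ) (μ₀ : EuclideanSpace ℝ (Fin n)) :
    Measurable (filteredNoise A C K μ₀) := by
  have hI := measurable_initialEstimate C K μ₀
  refine (measurable_fst.comp (hI.comp measurable_fst)).prodMk (measurable_pi_lambda _ fun t => ?_)
  exact (measurable_innovation A C).comp (((measurable_errorStep A C K).iterate t).comp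
    ((measurable_snd.comp (hI.comp measurable_fst)).prodMk measurable_snd))

/-- The estimation error is invisible to `C`. -/
theorem toEuclideanLin_error_eq_zero (A : Matrix (Fin n) (Fin n) ℝ) {C : Matrix (Fin q) (Fin n) ℝ}
    {K : Matrix (Fin n) (Fin q) ℝ} (hCK : C * K = 1) (μ₀ : EuclideanSpace ℝ (Fin n))
    (ω : EuclideanSpace ℝ (Fin n) × (ℕ → EuclideanSpace ℝ (Fin n))) (t : ℕ) :
    C.toEuclideanLin ((errorStep A C K)^[t] ((initialEstimate C K μ₀ ω.1).2, ω.2)).1 = 0 := by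
  cases t with
  | zero => exact toEuclideanLin_comp_one_sub_mul_eq_zero hCK _
  | succ t =>
    rw [Function.iterate_succ_apply']
    exact toEuclideanLin_comp_one_sub_mul_eq_zero hCK _

end Laws

/-! ### Equality of the output laws. -/

theorem corollary1 {n m p q : ℕ} (hqn : q < n)
    (U : Set (EuclideanSpace ℝ (Fin m)))
    (A : Matrix (Fin n) (Fin n) ℝ) (B : Matrix (Fin n) (Fin m) ℝ)
    (H : Matrix (Fin p) (Fin n) ℝ) (C : Matrix (Fin q) (Fin n) ℝ)
    (N : Matrix (Fin p) (Fin q) ℝ) (hNC : N * C = H)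
    (μ₀ : EuclideanSpace ℝ (Fin n)) (Sig₀ Q : Matrix (Fin n) (Fin n) ℝ)
    (hQ : Q.PosSemidef)
    (hSig₀ : IsStabilizingDARESolution A C Q Sig₀)
    (hC : (C * Sig₀ * C.transpose).PosDef) :
    ∀ cbar : Controller n U, ∃ c : Controller n U,
      ∀ Zφ : Set (ℕ → EuclideanSpace ℝ (Fin p)), MeasurableSet Zφ →
        (abstractModel A B H C μ₀ Sig₀).outputLaw cbar Zφ =
          (originalModel A B H μ₀ Sig₀ Q).outputLaw c Zφ := by
  intro cbar
  refine ⟨cbar.compKalmanFilter A B C (kalmanGain C Sig₀) μ₀, fun Zφ _ => ?_⟩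
  have hout : (originalModel A B H μ₀ Sig₀ Q).output
      (cbar.compKalmanFilter A B C (kalmanGain C Sig₀) μ₀)
      = (abstractModel A B H C μ₀ Sig₀).output cbar
        ∘ filteredNoise A C (kalmanGain C Sig₀) μ₀ := by
    funext ω t
    have hH : ∀ y, H.toEuclideanLin y = N.toEuclideanLin (C.toEuclideanLin y) := fun y => by
      rw [← hNC, Matrix.toLpLin_mul_same]
      rfl
    have hx := (kalmanFilter_execution A B H C μ₀ Sig₀ Q cbar ω t).2
    change H.toEuclideanLin _ = H.toEuclideanLin _
    -- The pattern `Prod.fst _` matches the error and not the estimate, so `H = N C` is used only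
    -- there.
    rw [hx, map_add, hH (Prod.fst _), toEuclideanLin_error_eq_zero A (mul_kalmanGain hC),
      map_zero, add_zero]
  rw [LinearGaussianSystem.outputLaw, LinearGaussianSystem.outputLaw, hout,
    ← map_filteredNoise B H μ₀ hQ hSig₀.1 hSig₀.2.1 hC,
    Measure.map_map (LinearGaussianSystem.measurable_output _ _)
      (measurable_filteredNoise A C (kalmanGain C Sig₀) μ₀)]
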